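/- Let $N\ge 3$ be an integer and let $\mathcal A_N$ be the complex Lie algebra generated by letters $\mathbf e_i$, where the index $i$ is read modulo $N$ (so there are $N$ generators $\mathbf e_1,\dots,\mathbf e_N$), subject to the defining relations $$[\mathbf e_i,[\mathbf e_i,\mathbf e_j]]=\mathbf e_j \ \text{ if } j\equiv i\pm 1 \pmod N,\qquad [\mathbf e_i,\mathbf e_j]=0\ \text{ otherwise}.$$ For an index $k$ modulo $N$ and $r\ge 1$ let $S_k(r)$ be the right-nested commutator $$S_k(r)=[\mathbf e_k,[\mathbf e_{k+1},[\dots,[\mathbf e_{k+r-2},\mathbf e_{k+r-1}]\dots]]],\qquad S_k(1)=\mathbf e_k .$$ Then for every integer $m\ge 1$ the element $$x(m)=\sum_{i=1}^{N} S_i(Nm)\in\mathcal A_N$$ vanishes: $x(m)=0$. -/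

import Mathlib

namespace OnsagerSl

/-- Adjacency of the vertices `i` and `j` of the Dynkin graph of type `A_{N-1}^{(1)}`: the cycle
on `N` vertices, labelled by the residues modulo `N` (the label `N` is the residue `0`). -/
def Adjacent {N : ℕ} (i j : ZMod N) : Prop :=
  j = i + 1 ∨ i = j + 1

/-- The elements `[e_i, [e_i, e_j]] - e_j` (for `i`, `j` adjacent) and `[e_i, e_j]` (for `i`, `j`
not adjacent) of the free complex Lie algebra on the letters `e_i`. -/
inductive IsRelator (N : ℕ) : FreeLieAlgebra ℂ (ZMod N) → Prop
  | adjacent (i j : ZMod N) (h : Adjacent i j) :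
      IsRelator N (⁅FreeLieAlgebra.of ℂ i, ⁅FreeLieAlgebra.of ℂ i, FreeLieAlgebra.of ℂ j⁆⁆ -
        FreeLieAlgebra.of ℂ j)
  | nonadjacent (i j : ZMod N) (h : ¬ Adjacent i j) :
      IsRelator N ⁅FreeLieAlgebra.of ℂ i, FreeLieAlgebra.of ℂ j⁆

/-- The Lie ideal of the free Lie algebra generated by the defining relations. -/
noncomputable def relationIdeal (N : ℕ) : LieIdeal ℂ (FreeLieAlgebra ℂ (ZMod N)) :=
  LieSubmodule.lieSpan ℂ (FreeLieAlgebra ℂ (ZMod N)) {a | IsRelator N a}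

/-- The `sl(N)` Onsager algebra `𝒜_N`: the complex Lie algebra generated by the letters `e_i`
subject to the defining relations. -/
abbrev SlNAlgebra (N : ℕ) : Type :=
  FreeLieAlgebra ℂ (ZMod N) ⧸ relationIdeal N

/-- The generator `e_i` of `𝒜_N`. -/
noncomputable def e {N : ℕ} (i : ZMod N) : SlNAlgebra N :=
  LieSubmodule.Quotient.mk (FreeLieAlgebra.of ℂ i)

/-- The string `S_k(r) = [e_k, [e_{k+1}, [… , e_{k+r-1}] … ]]` of length `r`; the string of
length `0` is `0`. -/
noncomputable def string {N : ℕ} : ZMod N → ℕ → SlNAlgebra N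
  | _, 0 => 0
  | k, 1 => e k
  | k, r + 2 => ⁅e k, string (k + 1) (r + 1)⁆

/-- The element `x(m) = S_1(Nm) + ⋯ + S_N(Nm)`. -/
noncomputable def closedSum (N m : ℕ) : SlNAlgebra N :=
  ∑ i ∈ Finset.Icc 1 N, string (i : ZMod N) (N * m)

end OnsagerSl

namespace OnsagerSl

/-! ### Two adjacent generators acting on one vector -/

section RankTwo

variable {L : Type*} [LieRing L] [LieAlgebra ℂ L]

/-! Rescale to `g i = I • e i`. Induction on length (`OnsagerRel.row`, `OnsagerRel.col`) gives the
brackets of generators with strings S_k(r), and from these some brackets of two strings. Fix `a` and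
put e = g_a, h_q = S_a((q+1)N), ξ_q = S_a((q+1)N+1), η_q = S_{a+1}((q+1)N-1), and let c_q be the sum
of all strings of length (q+1)N. Each c_q commutes with every generator, and γ_q = ξ_q - 2η_q
commutes with e.

Since ad γ_0 sends ξ_q to 2h_{q+1} and h_q to -2ξ_{q+1}, it shifts indices and yields [ξ_i, ξ_j] =
j[γ_0, γ_{i+j}] - 2c_{i+j+1}. The left side is antisymmetric, the right side is not visibly so:
comparing (m,0) with (0,m) gives 4c_{m+1} = m[γ_0, γ_m]. For m ≥ 1 the last bracket is 8c_{m-1} -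
2c_{m+1}, hence (2m+4)c_{m+1} = 8m c_{m-1}. As c_0 = 0 and c_1 = 0, every c_q vanishes. -/

theorem serre_apply {d e : L} (h : ⁅d, ⁅d, e⁆⁆ = -e) (z : L) :
    ⁅d, ⁅d, ⁅e, z⁆⁆⁆ - (2 : ℂ) • ⁅d, ⁅e, ⁅d, z⁆⁆⁆ + ⁅e, ⁅d, ⁅d, z⁆⁆⁆ = -⁅e, z⁆ := by
  have h1 : ⁅⁅d, ⁅d, e⁆⁆, z⁆ = -⁅e, z⁆ := by rw [h, neg_lie]
  rw [← h1]
  simp only [lie_lie, lie_sub]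
  module

/-- Two elements satisfying the relations of adjacent generators, together with a vector on which
the squares of both act by `-1`. -/
structure RankTwoTriple {L : Type*} [LieRing L] (d e z : L) : Prop where
  sq_left : ⁅d, ⁅d, e⁆⁆ = -e
  sq_right : ⁅e, ⁅e, d⁆⁆ = -d
  left_vec : ⁅d, ⁅d, z⁆⁆ = -z
  right_vec : ⁅e, ⁅e, z⁆⁆ = -z

namespace RankTwoTriple

variable {d e z : L}

theorem symm {L : Type*} [LieRing L] {d e z : L} (h : RankTwoTriple d e z) : RankTwoTriple e d z :=
  ⟨h.sq_right, h.sq_left, h.right_vec, h.left_vec⟩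

theorem dde (h : RankTwoTriple d e z) : ⁅d, ⁅d, ⁅e, z⁆⁆⁆ = (2 : ℂ) • ⁅d, ⁅e, ⁅d, z⁆⁆⁆ := by
  have h1 := serre_apply h.sq_left z
  rw [h.left_vec, lie_neg] at h1
  linear_combination (norm := module) (1 : ℂ) • h1

theorem dded (h : RankTwoTriple d e z) :
    ⁅d, ⁅d, ⁅e, ⁅d, z⁆⁆⁆⁆ = -((2 : ℂ) • ⁅d, ⁅e, z⁆⁆) := by
  have h1 := serre_apply h.sq_left ⁅d, z⁆
  simp only [h.left_vec, lie_neg] at h1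
  linear_combination (norm := module) (1 : ℂ) • h1

theorem ddde (h : RankTwoTriple d e z) :
    ⁅d, ⁅d, ⁅d, ⁅e, z⁆⁆⁆⁆ = -((4 : ℂ) • ⁅d, ⁅e, z⁆⁆) := by
  rw [h.dde, lie_smul, h.dded]
  module

theorem braid (h : RankTwoTriple d e z) :
    ⁅d, ⁅e, ⁅d, ⁅e, z⁆⁆⁆⁆ = ⁅e, ⁅d, ⁅e, ⁅d, z⁆⁆⁆⁆ := by
  have h1 := serre_apply h.sq_left ⁅e, z⁆
  simp only [h.right_vec, lie_neg, h.left_vec, h.dde, lie_smul] at h1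
  linear_combination (norm := module) (-1 / 2 : ℂ) • h1

/-- In the Serre identity on [d,[e,z]], the braid relation turns the middle term into -4 times the
left side, so it can be solved for. -/
theorem ddede (h : RankTwoTriple d e z) :
    ⁅d, ⁅d, ⁅e, ⁅d, ⁅e, z⁆⁆⁆⁆⁆ = -⁅e, ⁅d, ⁅e, z⁆⁆⁆ := by
  have h1 := serre_apply h.sq_left ⁅d, ⁅e, z⁆⁆
  rw [h.ddde, h.dde, lie_smul, lie_smul, ← h.braid, lie_neg, lie_smul] at h1
  linear_combination (norm := module) (-1 / 3 : ℂ) • h1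

end RankTwoTriple
end RankTwo

/-! ### Strings of length not divisible by N -/

section Nest

variable {L : Type*} [LieRing L] {N : ℕ}

/-- The right-nested commutator of the elements `g k, g (k + 1), …, g (k + r - 1)`. -/
def nest (g : ZMod N → L) : ZMod N → ℕ → L
  | _, 0 => 0
  | k, 1 => g k
  | k, r + 2 => ⁅g k, nest g (k + 1) (r + 1)⁆

/-- The defining relations of `𝒜_N` for the family `I • e_i`. -/
structure OnsagerRel (g : ZMod N → L) : Prop where
  three_le : 3 ≤ N
  up : ∀ i, ⁅g i, ⁅g i, g (i + 1)⁆⁆ = -g (i + 1)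
  down : ∀ i, ⁅g (i + 1), ⁅g (i + 1), g i⁆⁆ = -g i
  comm : ∀ i j, j ≠ i + 1 → i ≠ j + 1 → ⁅g i, g j⁆ = 0

@[simp] theorem nest_zero (g : ZMod N → L) (k : ZMod N) : nest g k 0 = 0 := rfl

@[simp] theorem nest_one (g : ZMod N → L) (k : ZMod N) : nest g k 1 = g k := rfl

theorem nest_succ (g : ZMod N → L) (k : ZMod N) {r : ℕ} (hr : 1 ≤ r) :
    nest g k (r + 1) = ⁅g k, nest g (k + 1) r⁆ := by
  obtain ⟨s, rfl⟩ := Nat.exists_eq_add_of_le' hr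
  rfl

theorem lie_nest_comm {g : ZMod N → L} {a b : ZMod N} (h : ⁅g a, g b⁆ = 0) (y : L) :
    ⁅g a, ⁅g b, y⁆⁆ = ⁅g b, ⁅g a, y⁆⁆ := by
  rw [leibniz_lie, h, zero_lie, zero_add]

theorem natCast_ne_zero_of_lt {k : ℕ} (h0 : 0 < k) (h : k < N) : (k : ZMod N) ≠ 0 := by
  rw [Ne, ZMod.natCast_eq_zero_iff]
  exact fun hd => absurd (Nat.le_of_dvd h0 hd) (by omega)

namespace OnsagerRel

variable {g : ZMod N → L}

/-- Generators whose labels differ by `k` with `2 ≤ k ≤ N - 2` commute. -/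
theorem comm_add (h : OnsagerRel g) {a b : ZMod N} {k : ℕ} (hb : b = a + k) (h2 : 2 ≤ k)
    (hk : k + 2 ≤ N) : ⁅g b, g a⁆ = 0 := by
  subst hb
  apply h.comm
  · intro e1
    refine natCast_ne_zero_of_lt (N := N) (k := k + 1) (by omega) (by omega) ?_
    push_cast; linear_combination -e1
  · intro e1
    obtain ⟨s, rfl⟩ := Nat.exists_eq_add_of_le' (show 1 ≤ k by omega)
    refine natCast_ne_zero_of_lt (N := N) (k := s) (by omega) (by omega) ?_
    push_cast at e1; linear_combination e1

end OnsagerRel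

/-- The brackets of the generators with the strings of length not divisible by `N` and lying
between `q * N` and `(q + 1) * N`. -/
structure Row [LieAlgebra ℂ L] (g : ZMod N → L) (q : ℕ) : Prop where
  diag : ∀ a, ⁅g a, nest g a (q * N + 1)⁆ = (2 : ℂ) • nest g a (q * N)
  right : ∀ r, 1 ≤ r → r + 1 < N → ∀ a : ZMod N,
    ⁅g (a + r), nest g a (q * N + r)⁆ = -nest g a (q * N + r + 1)
  left : ∀ r, 1 ≤ r → r + 1 < N → ∀ a : ZMod N,
    ⁅g a, nest g a (q * N + r + 1)⁆ = -nest g (a + 1) (q * N + r)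
  down : ∀ r, 1 ≤ r → r + 1 < N → ∀ a : ZMod N,
    ⁅g (a + r), nest g a (q * N + r + 1)⁆ = nest g a (q * N + r)
  zero : ∀ r, 1 ≤ r → r < N → ∀ a i : ZMod N, i ≠ a - 1 → i ≠ a → i + 1 ≠ a + r → i ≠ a + r →
    ⁅g i, nest g a (q * N + r)⁆ = 0

namespace OnsagerRel

variable {g : ZMod N → L}

theorem right_of_start (h : OnsagerRel g) {q : ℕ}
    (h1 : ∀ a, ⁅g (a + 1), nest g a (q * N + 1)⁆ = -nest g a (q * N + 2)) :
    ∀ r, 1 ≤ r → r + 1 < N → ∀ a : ZMod N,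
      ⁅g (a + r), nest g a (q * N + r)⁆ = -nest g a (q * N + r + 1) := by
  intro r hr
  induction r, hr using Nat.le_induction with
  | base => intro _ a; simpa using h1 a
  | succ r hr ih =>
    intro hN a
    rw [← add_assoc, nest_succ _ _ (by omega), lie_nest_comm (h.comm_add rfl (by omega) (by omega)),
      nest_succ g a (r := q * N + r + 1) (by omega)]
    have := ih (by omega) (a + 1)
    rw [show a + ((r + 1 : ℕ) : ZMod N) = a + 1 + r by push_cast; ring, this, lie_neg]

theorem down_of_start (h : OnsagerRel g) {q : ℕ}
    (h1 : ∀ a, ⁅g (a + 1), nest g a (q * N + 2)⁆ = nest g a (q * N + 1)) :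
    ∀ r, 1 ≤ r → r + 1 < N → ∀ a : ZMod N,
      ⁅g (a + r), nest g a (q * N + r + 1)⁆ = nest g a (q * N + r) := by
  intro r hr
  induction r, hr using Nat.le_induction with
  | base => intro _ a; simpa using h1 a
  | succ r hr ih =>
    intro hN a
    rw [nest_succ _ _ (by omega), lie_nest_comm (h.comm_add rfl (by omega) (by omega)),
      ← add_assoc, nest_succ g a (r := q * N + r) (by omega)]
    have := ih (by omega) (a + 1)
    rw [show a + ((r + 1 : ℕ) : ZMod N) = a + 1 + r by push_cast; ring, this]

/-- The induction peels off the last letter, which commutes with `g a`; `hright` is what rebuilds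
the string from that end. -/
theorem left_of_start (h : OnsagerRel g) {q : ℕ}
    (hright : ∀ r, 1 ≤ r → r + 1 < N → ∀ a : ZMod N,
      ⁅g (a + r), nest g a (q * N + r)⁆ = -nest g a (q * N + r + 1))
    (h1 : ∀ a, ⁅g a, nest g a (q * N + 2)⁆ = -nest g (a + 1) (q * N + 1)) :
    ∀ r, 1 ≤ r → r + 1 < N → ∀ a : ZMod N,
      ⁅g a, nest g a (q * N + r + 1)⁆ = -nest g (a + 1) (q * N + r) := by
  intro r hr
  induction r, hr using Nat.le_induction with
  | base => intro _ a; simpa using h1 a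
  | succ r hr ih =>
    intro hN a
    have e1 := hright r hr (by omega) (a + 1)
    have e2 : nest g (a + 1) (q * N + r + 1) =
        -⁅g (a + ((r + 1 : ℕ) : ZMod N)), nest g (a + 1) (q * N + r)⁆ := by
      rw [show a + ((r + 1 : ℕ) : ZMod N) = a + 1 + r by push_cast; ring, e1, neg_neg]
    have hc : ⁅g a, g (a + ((r + 1 : ℕ) : ZMod N))⁆ = 0 := by
      rw [← lie_skew, h.comm_add rfl (by omega) (by omega), neg_zero]
    rw [← add_assoc, nest_succ _ _ (by omega), e2, lie_neg, lie_neg, lie_nest_comm hc,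
      lie_nest_comm hc, ← nest_succ g a (by omega), ih (by omega), lie_neg]

variable [LieAlgebra ℂ L]

theorem zero_of_start (h : OnsagerRel g) {q : ℕ}
    (hleft : ∀ r, 1 ≤ r → r + 1 < N → ∀ a : ZMod N,
      ⁅g a, nest g a (q * N + r + 1)⁆ = -nest g (a + 1) (q * N + r))
    (h1 : ∀ a i, i ≠ a - 1 → i ≠ a → i ≠ a + 1 → ⁅g i, nest g a (q * N + 1)⁆ = 0) :
    ∀ r, 1 ≤ r → r < N → ∀ a i : ZMod N, i ≠ a - 1 → i ≠ a → i + 1 ≠ a + r → i ≠ a + r →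
      ⁅g i, nest g a (q * N + r)⁆ = 0 := by
  intro r
  induction r using Nat.strong_induction_on with
  | _ r ih =>
  intro hr hN a i i1 i2 i3 i4
  obtain rfl | hr := hr.eq_or_lt
  · exact h1 a i i1 i2 (by simpa using i4)
  obtain ⟨s, rfl⟩ := Nat.exists_eq_add_of_le' (show 1 ≤ r by omega)
  push_cast at i3 i4
  rw [← add_assoc, nest_succ _ _ (by omega)]
  by_cases hi : i = a + 1
  · subst hi
    obtain rfl | hs := (show 1 ≤ s by omega).eq_or_lt
    · exact absurd (by push_cast; ring) i3
    obtain ⟨t, rfl⟩ := Nat.exists_eq_add_of_le' (show 1 ≤ s by omega)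
    have hz : ⁅g a, nest g (a + 1 + 1) (q * N + t)⁆ = 0 := by
      apply ih t (by omega) (by omega) (by omega)
      · intro e1
        refine natCast_ne_zero_of_lt (N := N) (k := 1) (by omega) (by omega) ?_
        push_cast; linear_combination -e1
      · intro e1
        refine natCast_ne_zero_of_lt (N := N) (k := 2) (by omega) (by omega) ?_
        push_cast; linear_combination -e1
      · intro e1
        refine natCast_ne_zero_of_lt (N := N) (k := t + 1) (by omega) (by omega) ?_
        push_cast; linear_combination -e1
      · intro e1
        refine natCast_ne_zero_of_lt (N := N) (k := t + 2) (by omega) (by omega) ?_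
        push_cast; linear_combination -e1
    have hl := hleft t (by omega) (by omega) (a + 1)
    rw [← add_assoc, nest_succ g (a + 1) (by omega)] at *
    set Z := nest g (a + 1 + 1) (q * N + t)
    -- `g a` kills Z and ad `g (a + 1)` squares to -1 on Z, so only the middle Serre term survives.
    have hs := serre_apply (h.down a) Z
    rw [hz, hl, lie_zero, lie_zero, lie_neg, hz] at hs
    have h2 : ⁅g (a + 1), ⁅g a, ⁅g (a + 1), Z⁆⁆⁆ = 0 := by
      linear_combination (norm := module) (-1 / 2 : ℂ) • hs
    exact h2
  · have hc : ⁅g i, g a⁆ = 0 := by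
      refine h.comm _ _ (fun e1 => i1 (by rw [e1]; ring)) hi
    rw [lie_nest_comm hc, ih s (by omega) (by omega) (by omega) (a + 1) i _ hi, lie_zero]
    · intro e1; apply i3; rw [e1]; ring
    · intro e1; apply i4; rw [e1]; ring
    · simpa using i2

theorem row_of_start (h : OnsagerRel g) {q : ℕ}
    (h0 : ∀ a, ⁅g a, nest g a (q * N + 1)⁆ = (2 : ℂ) • nest g a (q * N))
    (h1 : ∀ a, ⁅g (a + 1), nest g a (q * N + 1)⁆ = -nest g a (q * N + 2))
    (h2 : ∀ a, ⁅g a, nest g a (q * N + 2)⁆ = -nest g (a + 1) (q * N + 1))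
    (h3 : ∀ a, ⁅g (a + 1), nest g a (q * N + 2)⁆ = nest g a (q * N + 1))
    (h4 : ∀ a i, i ≠ a - 1 → i ≠ a → i ≠ a + 1 → ⁅g i, nest g a (q * N + 1)⁆ = 0) :
    Row g q :=
  have hr := h.right_of_start h1
  have hl := h.left_of_start hr h2
  ⟨h0, hr, hl, h.down_of_start h3, h.zero_of_start hl h4⟩

theorem row_zero (h : OnsagerRel g) : Row g 0 := by
  apply h.row_of_start
  · intro a; simp
  · intro a
    rw [zero_mul, zero_add, zero_add, nest_succ g a le_rfl, nest_one, nest_one, ← lie_skew]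
  · intro a
    rw [zero_mul, zero_add, zero_add, nest_succ g a le_rfl, nest_one, h.up]
  · intro a
    rw [zero_mul, zero_add, zero_add, nest_succ g a le_rfl, nest_one, nest_one,
      ← lie_skew (g a), lie_neg, h.down, neg_neg]
  · intro a i i1 i2 i3
    rw [zero_mul, zero_add, nest_one]
    exact h.comm _ _ (fun e1 => i1 (by rw [e1]; ring)) i3

end OnsagerRel
end Nest

/-! ### Crossing the multiples of N -/

section Multiples

variable {L : Type*} [LieRing L] {N : ℕ}

theorem lie_nest_eq_zero {g : ZMod N → L} {y : L} {c : ZMod N} {s : ℕ} (h : ∀ j < s, ⁅g (c + j), y⁆ = 0) :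
    ⁅nest g c s, y⁆ = 0 := by
  induction s generalizing c with
  | zero => simp
  | succ s ih =>
    have h0 : ⁅g c, y⁆ = 0 := by simpa using h 0 (by omega)
    obtain rfl | hs := s.eq_zero_or_pos
    · simpa using h0
    · rw [nest_succ _ _ hs, lie_lie, h0, ih, lie_zero, lie_zero, sub_zero]
      intro j hj
      have := h (j + 1) (by omega)
      rwa [show c + ((j + 1 : ℕ) : ZMod N) = c + 1 + j by push_cast; ring] at this

variable [LieAlgebra ℂ L]

/-- The brackets of the generators with the strings of length `n`, a positive multiple of `N`. -/
structure Col (g : ZMod N → L) (n : ℕ) : Prop where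
  self : ∀ a, ⁅g a, nest g a n⁆ = -((2 : ℂ) • nest g a (n + 1))
  up : ∀ a, ⁅g (a + 1), nest g a n⁆ = nest g (a + 1) (n + 1)
  zero : ∀ a i : ZMod N, i ≠ a - 1 → i ≠ a → i ≠ a + 1 → ⁅g i, nest g a n⁆ = 0
  triple : ∀ a, ∃ z, RankTwoTriple (g a) (g (a + 1)) z ∧
    nest g a n = ⁅g a, ⁅g (a + 1), z⁆⁆ ∧ nest g (a + 1) n = -⁅g (a + 1), ⁅g a, z⁆⁆

variable {g : ZMod N → L}

theorem OnsagerRel.col_of_row (h : OnsagerRel g) {q : ℕ} (hr : Row g q) :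
    Col g ((q + 1) * N) := by
  obtain ⟨M, hM, hM1⟩ : ∃ M, N = M + 2 ∧ 1 ≤ M := ⟨N - 2, by have := h.three_le; omega,
    by have := h.three_le; omega⟩
  have hn : (q + 1) * N = q * N + M + 1 + 1 := by rw [add_one_mul]; omega
  have hcast : ((M : ℕ) : ZMod N) = -2 := by
    have : ((M + 2 : ℕ) : ZMod N) = 0 := by rw [← hM]; exact ZMod.natCast_self N
    push_cast at this; linear_combination this
  have htriple : ∀ a, ∃ z, RankTwoTriple (g a) (g (a + 1)) z ∧
      nest g a ((q + 1) * N) = ⁅g a, ⁅g (a + 1), z⁆⁆ ∧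
      nest g (a + 1) ((q + 1) * N) = -⁅g (a + 1), ⁅g a, z⁆⁆ := by
    intro a
    have e1 := hr.right M hM1 (by omega) (a + 1 + 1)
    have e2 := hr.down M hM1 (by omega) (a + 1 + 1)
    have e3 := hr.left M hM1 (by omega) (a + 1)
    rw [show a + 1 + 1 + (M : ZMod N) = a by rw [hcast]; ring] at e1 e2
    have e4 := nest_succ g (a + 1) (r := q * N + M) (by omega)
    -- This string starts just after `a + 1` and ends just before `a`, so `g (a + 1)` extends it on
    -- the left and `g a` on the right.
    refine ⟨nest g (a + 1 + 1) (q * N + M), ⟨h.up a, h.down a, ?_, ?_⟩, ?_, ?_⟩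
    · rw [e1, lie_neg, e2]
    · rw [← e4, e3]
    · rw [hn, nest_succ _ _ (by omega), e4]
    · rw [hn, nest_succ _ _ (by omega), e1, lie_neg, neg_neg]
  have hself : ∀ a, ⁅g a, nest g a ((q + 1) * N)⁆ =
      -((2 : ℂ) • nest g a ((q + 1) * N + 1)) := by
    intro a
    obtain ⟨z, hz, z1, z2⟩ := htriple a
    rw [nest_succ _ _ (by omega), z1, z2, hz.dde, lie_neg]
    module
  refine ⟨hself, ?_, ?_, htriple⟩
  · intro a
    obtain ⟨z, hz, z1, z2⟩ := htriple a
    have e1 := hself (a + 1)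
    rw [z2, lie_neg, hz.symm.dde, ← z1] at e1
    linear_combination (norm := module) (-1 / 2 : ℂ) • e1
  · intro a i i1 i2 i3
    rw [hn, nest_succ _ _ (by omega), lie_nest_comm, add_assoc (q * N), hr.zero (M + 1), lie_zero]
    · omega
    · omega
    · simpa using i2
    · exact i3
    · push_cast; rw [hcast]; intro e1; apply i1; linear_combination e1
    · push_cast; rw [hcast]; intro e1; apply i2; linear_combination e1
    · exact h.comm _ _ (fun e1 => i1 (by rw [e1]; ring)) i3

/-- With d, e, z from `Col.triple`, the strings of lengths qN, qN+1, qN+2 become words in ad d, ad e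
applied to z, and the starting relations of the row are the rank-two identities. -/
theorem Col.row (h : OnsagerRel g) {q : ℕ} (hq : 1 ≤ q * N) (hc : Col g (q * N)) : Row g q := by
  -- Needed for the vanishing relations: unfolding would produce S_{a+1}(qN), about which `Col.zero`
  -- is silent for `g (a + 2)`.
  have hX : ∀ a, nest g a (q * N + 1) = (-1 / 2 : ℂ) • ⁅g a, nest g a (q * N)⁆ := by
    intro a
    linear_combination (norm := module) (1 / 2 : ℂ) • hc.self a
  have hXX : ∀ a, ∃ z, RankTwoTriple (g a) (g (a + 1)) z ∧
      nest g a (q * N) = ⁅g a, ⁅g (a + 1), z⁆⁆ ∧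
      nest g a (q * N + 1) = -⁅g a, ⁅g (a + 1), ⁅g a, z⁆⁆⁆ ∧
      nest g (a + 1) (q * N + 1) = ⁅g (a + 1), ⁅g a, ⁅g (a + 1), z⁆⁆⁆ := by
    intro a
    obtain ⟨z, hz, z1, z2⟩ := hc.triple a
    refine ⟨z, hz, z1, ?_, ?_⟩
    · rw [nest_succ _ _ hq, z2, lie_neg]
    · rw [← hc.up a, z1]
  apply h.row_of_start
  · intro a
    obtain ⟨z, hz, z1, z2, z3⟩ := hXX a
    rw [z1, z2, lie_neg, hz.dded]
    module
  · intro a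
    obtain ⟨z, hz, z1, z2, z3⟩ := hXX a
    rw [nest_succ g a (r := q * N + 1) (by omega), z3, z2, lie_neg, hz.braid]
  · intro a
    obtain ⟨z, hz, z1, z2, z3⟩ := hXX a
    rw [nest_succ g a (r := q * N + 1) (by omega), z3, hz.ddede]
  · intro a
    obtain ⟨z, hz, z1, z2, z3⟩ := hXX a
    rw [nest_succ g a (r := q * N + 1) (by omega), z3, z2, hz.braid, hz.symm.ddede]
  · intro a i i1 i2 i3
    rw [hX, lie_smul, lie_nest_comm, hc.zero a i i1 i2 i3, lie_zero, smul_zero]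
    exact h.comm _ _ (fun e1 => i1 (by rw [e1]; ring)) i3

theorem OnsagerRel.row (h : OnsagerRel g) : ∀ q, Row g q
  | 0 => h.row_zero
  | q + 1 => (h.col_of_row (h.row q)).row h (by
      have := h.three_le
      rw [add_one_mul]; omega)

theorem OnsagerRel.col (h : OnsagerRel g) {q : ℕ} (hq : 1 ≤ q) : Col g (q * N) := by
  obtain ⟨s, rfl⟩ := Nat.exists_eq_add_of_le' hq
  exact h.col_of_row (h.row s)

end Multiples

/-! ### Brackets of two strings -/

section Products

variable {L : Type*} [LieRing L] [LieAlgebra ℂ L] {N : ℕ} {g : ZMod N → L}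

namespace OnsagerRel

theorem nest_right (h : OnsagerRel g) {q r : ℕ} (h1 : 1 ≤ r) (h2 : r + 1 < N) (a : ZMod N) :
    ⁅nest g a (q * N + r), g (a + r)⁆ = nest g a (q * N + r + 1) := by
  rw [← lie_skew, (h.row q).right r h1 h2, neg_neg]

/-- Joining a short string to the right end of a string. -/
theorem lie_nest_short (h : OnsagerRel g) (q : ℕ) {s : ℕ} (hs : 1 ≤ s) :
    ∀ {p : ℕ}, 1 ≤ p → p + s < N → ∀ b : ZMod N,
      ⁅nest g b (q * N + p), nest g (b + p) s⁆ = nest g b (q * N + p + s) := by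
  induction s, hs using Nat.le_induction with
  | base => intro p hp hN b; exact h.nest_right hp hN b
  | succ s hs ih =>
    intro p hp hN b
    have h0 : ⁅nest g (b + p + 1) s, nest g b (q * N + p)⁆ = 0 := by
      apply lie_nest_eq_zero
      intro j hj
      apply (h.row q).zero p hp (by omega)
      · intro e1
        refine natCast_ne_zero_of_lt (N := N) (k := p + j + 2) (by omega) (by omega) ?_
        push_cast; linear_combination e1
      · intro e1
        refine natCast_ne_zero_of_lt (N := N) (k := p + j + 1) (by omega) (by omega) ?_
        push_cast; linear_combination e1
      · intro e1
        refine natCast_ne_zero_of_lt (N := N) (k := j + 2) (by omega) (by omega) ?_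
        push_cast; linear_combination e1
      · intro e1
        refine natCast_ne_zero_of_lt (N := N) (k := j + 1) (by omega) (by omega) ?_
        push_cast; linear_combination e1
    have e1 := ih (p := p + 1) (by omega) (by omega) b
    rw [nest_succ _ _ hs, leibniz_lie, h.nest_right hp (by omega), ← lie_skew (nest g b (q * N + p)), h0,
      neg_zero, lie_zero, add_zero]
    push_cast at e1
    rw [add_assoc b, add_assoc (q * N), e1]
    congr 1; ring

/-- Joining a short string to the left end of a string. -/
theorem nest_short_lie (h : OnsagerRel g) (q : ℕ) {p : ℕ} (hp : 1 ≤ p) {s : ℕ} (hs : 1 ≤ s) :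
    p + s < N → ∀ b : ZMod N,
      ⁅nest g b s, nest g (b + s) (q * N + p)⁆ = nest g b (q * N + p + s) := by
  induction s, hs using Nat.le_induction with
  | base => intro hN b; simp [nest_succ g b (r := q * N + p) (by omega)]
  | succ s hs ih =>
    intro hN b
    have h0 : ⁅g b, nest g (b + (s + 1 : ℕ)) (q * N + p)⁆ = 0 := by
      apply (h.row q).zero p hp (by omega)
      · intro e1
        refine natCast_ne_zero_of_lt (N := N) (k := s) (by omega) (by omega) ?_
        push_cast at e1; linear_combination -e1
      · intro e1
        refine natCast_ne_zero_of_lt (N := N) (k := s + 1) (by omega) (by omega) ?_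
        push_cast at e1 ⊢; linear_combination -e1
      · intro e1
        refine natCast_ne_zero_of_lt (N := N) (k := s + p) (by omega) (by omega) ?_
        push_cast at e1 ⊢; linear_combination -e1
      · intro e1
        refine natCast_ne_zero_of_lt (N := N) (k := s + 1 + p) (by omega) (by omega) ?_
        push_cast at e1 ⊢; linear_combination -e1
    have e1 := ih (by omega) (b + 1)
    rw [nest_succ _ _ hs, lie_lie, h0, lie_zero, sub_zero, ← add_assoc, nest_succ _ _ (by omega),
      ← e1]
    congr 3
    push_cast; ring

theorem nest_short_lie_multiple (h : OnsagerRel g) {q : ℕ} (hq : 1 ≤ q) {s : ℕ} (hs : 1 ≤ s) :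
    s + 2 ≤ N → ∀ b : ZMod N,
      ⁅nest g b s, nest g (b + s) (q * N)⁆ = nest g b (q * N + s) := by
  have hN := h.three_le
  have hqN : 1 ≤ q * N := Nat.mul_pos hq (by omega)
  induction s, hs using Nat.le_induction with
  | base => intro hN b; simp [nest_succ g b hqN]
  | succ s hs ih =>
    intro hN b
    have h0 : ⁅g b, nest g (b + (s + 1 : ℕ)) (q * N)⁆ = 0 := by
      apply (h.col hq).zero
      · intro e1
        refine natCast_ne_zero_of_lt (N := N) (k := s) (by omega) (by omega) ?_
        push_cast at e1; linear_combination -e1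
      · intro e1
        refine natCast_ne_zero_of_lt (N := N) (k := s + 1) (by omega) (by omega) ?_
        push_cast at e1 ⊢; linear_combination -e1
      · intro e1
        refine natCast_ne_zero_of_lt (N := N) (k := s + 2) (by omega) (by omega) ?_
        push_cast at e1 ⊢; linear_combination -e1
    have e1 := ih (by omega) (b + 1)
    rw [nest_succ _ _ hs, lie_lie, h0, lie_zero, sub_zero, ← add_assoc, nest_succ _ _ (by omega),
      ← e1]
    congr 3
    push_cast; ring

/-- Split the last letter off the short string: it kills the long string, being interior to it, so
only the term where it acts last remains. -/
theorem nest_lie_nest_same (h : OnsagerRel g) (q : ℕ) {s : ℕ} (hs : 1 ≤ s) :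
    ∀ {u : ℕ}, 1 ≤ u → s + u < N → ∀ b : ZMod N,
      ⁅nest g b s, nest g b (q * N + u + s)⁆ = -nest g (b + s) (q * N + u) := by
  induction s, hs using Nat.le_induction with
  | base => intro u hu hN b; simpa using (h.row q).left u hu (by omega) b
  | succ s hs ih =>
    intro u hu hN b
    have e0 := h.nest_right (q := 0) hs (by omega) b
    rw [zero_mul, zero_add] at e0
    have h0 : ⁅g (b + s), nest g b (q * N + (u + (s + 1)))⁆ = 0 := by
      apply (h.row q).zero _ (by omega) (by omega)
      · intro e1
        refine natCast_ne_zero_of_lt (N := N) (k := s + 1) (by omega) (by omega) ?_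
        push_cast; linear_combination e1
      · intro e1
        refine natCast_ne_zero_of_lt (N := N) (k := s) (by omega) (by omega) ?_
        linear_combination e1
      · intro e1
        refine natCast_ne_zero_of_lt (N := N) (k := u) (by omega) (by omega) ?_
        push_cast at e1; linear_combination -e1
      · intro e1
        refine natCast_ne_zero_of_lt (N := N) (k := u + 1) (by omega) (by omega) ?_
        push_cast at e1 ⊢; linear_combination -e1
    have e1 := ih (u := u + 1) (by omega) (by omega) b
    have e2 := (h.row q).left u hu (by omega) (b + s)
    rw [← e0, lie_lie, add_assoc (q * N), h0, lie_zero, zero_sub,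
      show q * N + (u + (s + 1)) = q * N + (u + 1) + s by ring, e1, lie_neg, neg_neg, ← add_assoc,
      e2]
    push_cast; rw [add_assoc]

/-- Splitting off the last letter, one Jacobi term is the inductive case and the other ends in
`Row.diag`, which adds one summand. -/
theorem nest_lie_nest_sum (h : OnsagerRel g) (q : ℕ) {s : ℕ} (hs : 1 ≤ s) :
    s < N → ∀ b : ZMod N, ⁅nest g b s, nest g b (q * N + s)⁆ =
      (2 : ℂ) • ∑ j ∈ Finset.range s, nest g (b + j) (q * N) := by
  induction s, hs using Nat.le_induction with
  | base => intro _ b; simpa using (h.row q).diag b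
  | succ s hs ih =>
    intro hN b
    have e0 := h.nest_right (q := 0) hs (by omega) b
    rw [zero_mul, zero_add] at e0
    have e1 := (h.row q).down s hs (by omega) b
    have e2 := h.nest_lie_nest_same q hs (u := 1) le_rfl (by omega) b
    rw [← e0, lie_lie, ← add_assoc, e1, ih (by omega), add_right_comm, e2, lie_neg,
      (h.row q).diag, Finset.sum_range_succ]
    module

/-- Moving the first letter of the short string onto the long one costs one closed string. At s =
N-1 all closed strings but one appear. -/
theorem nest_lie_nest_closing (h : OnsagerRel g) (q : ℕ) {s : ℕ} (hs : 1 ≤ s) :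
    ∀ {r : ℕ}, 1 ≤ r → r + s = N → ∀ b : ZMod N,
      ⁅nest g b (q * N + r), nest g (b + r) s⁆ =
        -∑ j ∈ Finset.range s, nest g (b - 1 - j) ((q + 1) * N) := by
  have hN := h.three_le
  induction s, hs using Nat.le_induction with
  | base =>
    intro r hr hrN b
    have hc : b + (r : ZMod N) = b - 1 := by
      have : ((r + 1 : ℕ) : ZMod N) = 0 := by rw [hrN]; exact ZMod.natCast_self N
      push_cast at this; linear_combination this
    rw [nest_one, hc, ← lie_skew, Finset.sum_range_one, Nat.cast_zero, sub_zero,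
      show (q + 1) * N = q * N + r + 1 by rw [add_one_mul]; omega, nest_succ _ _ (by omega),
      sub_add_cancel]
  | succ s hs ih =>
    intro r hr hrN b
    have hc : (r : ZMod N) = - (s + 1) := by
      have : ((r + (s + 1) : ℕ) : ZMod N) = 0 := by rw [hrN]; exact ZMod.natCast_self N
      push_cast at this; linear_combination this
    have e1 := ih (r := r + 1) (by omega) (by omega) b
    have e2 := h.nest_short_lie q hr hs (by omega) (b + r + 1)
    rw [show b + r + 1 + (s : ZMod N) = b by rw [hc]; ring] at e2
    rw [nest_succ _ _ hs, leibniz_lie, h.nest_right hr (by omega), ← lie_skew (nest g b (q * N + r)), e2,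
      lie_neg, ← nest_succ _ _ (by omega), show q * N + r + s + 1 = (q + 1) * N by
        rw [add_one_mul]; omega, Finset.sum_range_succ, neg_add, ← e1,
      show b - 1 - (s : ZMod N) = b + r by rw [hc]; ring]
    push_cast
    simp only [add_assoc]

end OnsagerRel
end Products

/-! ### The recurrence for the closed sums -/

section ImaginaryRoots

variable {L : Type*} [LieRing L] [LieAlgebra ℂ L]

/-- Families in a Lie algebra with the brackets that hold in `𝒜_N` between a generator `e`, the
strings `h q`, `ξ q`, `η q` attached to it and the central closed sums `c q`. -/
structure ClosedSumSystem (e : L) (h ξ η c : ℕ → L) : Prop where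
  lie_ξ : ∀ q, ⁅e, ξ q⁆ = (2 : ℂ) • h q
  lie_h : ∀ q, ⁅e, h q⁆ = -((2 : ℂ) • ξ q)
  lie_η : ∀ q, ⁅e, η q⁆ = h q
  ξ_η : ∀ q, ⁅ξ q, η 0⁆ = h (q + 1) - c (q + 1)
  h_η : ∀ q, ⁅h q, η 0⁆ = -((2 : ℂ) • η (q + 1))
  η_η : ∀ q, ⁅η 0, η (q + 1)⁆ = (2 : ℂ) • c q - (2 : ℂ) • h q
  lie_c : ∀ q, ⁅e, c q⁆ = 0
  ξ_c : ∀ q, ⁅ξ 0, c q⁆ = 0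
  η_c : ∀ q, ⁅η 0, c q⁆ = 0
  c_zero : c 0 = 0

namespace ClosedSumSystem

variable {e : L} {h ξ η c : ℕ → L}

theorem lie_γ (s : ClosedSumSystem e h ξ η c) (q : ℕ) : ⁅e, ξ q - (2 : ℂ) • η q⁆ = 0 := by
  rw [lie_sub, lie_smul, s.lie_ξ, s.lie_η, sub_self]

/-- This and the next three brackets come from applying the derivation ad e to a bracket already
known. -/
theorem ξ_h_zero (s : ClosedSumSystem e h ξ η c) (q : ℕ) :
    ⁅ξ q, h 0⁆ = -((2 : ℂ) • (ξ (q + 1) - (2 : ℂ) • η (q + 1))) := by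
  have e1 := leibniz_lie e (ξ q) (η 0)
  rw [s.ξ_η, lie_sub, s.lie_h, s.lie_c, s.lie_ξ, smul_lie, s.h_η, s.lie_η] at e1
  linear_combination (norm := module) (-1 : ℂ) • e1

theorem h_h_zero (s : ClosedSumSystem e h ξ η c) (q : ℕ) :
    ⁅h q, h 0⁆ = -((2 : ℂ) • c (q + 1)) := by
  have e1 := leibniz_lie e (h q) (η 0)
  rw [s.h_η, lie_neg, lie_smul, s.lie_η, s.lie_h, neg_lie, smul_lie, s.ξ_η, s.lie_η] at e1
  linear_combination (norm := module) (-1 : ℂ) • e1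

theorem ξ_ξ_zero (s : ClosedSumSystem e h ξ η c) (q : ℕ) :
    ⁅ξ q, ξ 0⁆ = -((2 : ℂ) • c (q + 1)) := by
  have e1 := leibniz_lie e (ξ q) (h 0)
  rw [s.ξ_h_zero, lie_neg, lie_smul, s.lie_γ, s.lie_ξ, smul_lie, s.h_h_zero, s.lie_h, lie_neg,
    lie_smul] at e1
  linear_combination (norm := module) (1 / 2 : ℂ) • e1

theorem h_ξ_zero (s : ClosedSumSystem e h ξ η c) (q : ℕ) :
    ⁅h q, ξ 0⁆ = (2 : ℂ) • (ξ (q + 1) - (2 : ℂ) • η (q + 1)) := by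
  have e1 := leibniz_lie e (ξ q) (ξ 0)
  rw [s.ξ_ξ_zero, lie_neg, lie_smul, s.lie_c, s.lie_ξ, s.lie_ξ, smul_lie, lie_smul,
    s.ξ_h_zero] at e1
  linear_combination (norm := module) (-1 / 2 : ℂ) • e1

theorem γ_ξ (s : ClosedSumSystem e h ξ η c) (q : ℕ) :
    ⁅ξ 0 - (2 : ℂ) • η 0, ξ q⁆ = (2 : ℂ) • h (q + 1) := by
  rw [sub_lie, smul_lie, ← lie_skew (ξ 0), ← lie_skew (η 0), s.ξ_ξ_zero, s.ξ_η]
  module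

theorem γ_h (s : ClosedSumSystem e h ξ η c) (q : ℕ) :
    ⁅ξ 0 - (2 : ℂ) • η 0, h q⁆ = -((2 : ℂ) • ξ (q + 1)) := by
  rw [sub_lie, smul_lie, ← lie_skew (ξ 0), ← lie_skew (η 0), s.h_ξ_zero, s.h_η]
  module

theorem ξ_zero_η (s : ClosedSumSystem e h ξ η c) (q : ℕ) :
    ⁅ξ 0, η (q + 1)⁆ = h (q + 2) + c (q + 2) - (4 : ℂ) • h q := by
  have e1 := leibniz_lie e (η 0) (η (q + 1))
  rw [s.η_η, lie_sub, lie_smul, lie_smul, s.lie_c, s.lie_h, s.lie_η, s.lie_η] at e1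
  -- A second ad e turns [h 0, η] and [η 0, h] into brackets that are known, apart from the one
  -- sought.
  have e2 := congrArg (fun y => ⁅e, y⁆) e1
  simp only [lie_sub, lie_add, lie_smul, lie_neg, s.lie_ξ, lie_zero] at e2
  rw [leibniz_lie e (h 0), leibniz_lie e (η 0), s.lie_h, s.lie_h, s.lie_η, s.lie_η, neg_lie,
    smul_lie, lie_neg, lie_smul, ← lie_skew (h 0), ← lie_skew (η 0), s.h_h_zero, s.ξ_η] at e2
  linear_combination (norm := module) (1 / 2 : ℂ) • e2

theorem γ_γ (s : ClosedSumSystem e h ξ η c) (q : ℕ) :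
    ⁅ξ 0 - (2 : ℂ) • η 0, ξ (q + 1) - (2 : ℂ) • η (q + 1)⁆ =
      (8 : ℂ) • c q - (2 : ℂ) • c (q + 2) := by
  rw [lie_sub, lie_smul, s.γ_ξ, sub_lie, smul_lie, s.ξ_zero_η, s.η_η]
  module

theorem γ_c (s : ClosedSumSystem e h ξ η c) (q : ℕ) : ⁅ξ 0 - (2 : ℂ) • η 0, c q⁆ = 0 := by
  rw [sub_lie, smul_lie, s.ξ_c, s.η_c, smul_zero, sub_zero]

/-- ad γ_0 moves an index from left to right. Each move adds one copy of [γ_0, γ_{i+j}], which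
commutes with e and γ_0; hence the coefficient `j`. -/
theorem brackets (s : ClosedSumSystem e h ξ η c) (j : ℕ) : ∀ i,
    ⁅h i, h j⁆ = (j : ℂ) • ⁅ξ 0 - (2 : ℂ) • η 0, ξ (i + j) - (2 : ℂ) • η (i + j)⁆ -
      (2 : ℂ) • c (i + j + 1) ∧
    ⁅ξ i, ξ j⁆ = (j : ℂ) • ⁅ξ 0 - (2 : ℂ) • η 0, ξ (i + j) - (2 : ℂ) • η (i + j)⁆ -
      (2 : ℂ) • c (i + j + 1) ∧
    ⁅h i, ξ j⁆ = (2 : ℂ) • (ξ (i + j + 1) - (2 : ℂ) • η (i + j + 1)) := by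
  have hZe : ∀ n, ⁅e, ⁅ξ 0 - (2 : ℂ) • η 0, ξ n - (2 : ℂ) • η n⁆⁆ = 0 := by
    intro n
    rw [leibniz_lie, s.lie_γ, s.lie_γ, zero_lie, lie_zero, add_zero]
  have hZG : ∀ n, ⁅ξ 0 - (2 : ℂ) • η 0, ⁅ξ 0 - (2 : ℂ) • η 0, ξ n - (2 : ℂ) • η n⁆⁆ = 0 := by
    rintro (_ | n)
    · rw [lie_self, lie_zero]
    · rw [s.γ_γ, lie_sub, lie_smul, lie_smul, s.γ_c, s.γ_c, smul_zero, smul_zero, sub_zero]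
  induction j with
  | zero =>
    intro i
    refine ⟨?_, ?_, s.h_ξ_zero i⟩
    · rw [s.h_h_zero]; simp
    · rw [s.ξ_ξ_zero]; simp
  | succ j ih =>
    intro i
    obtain ⟨hh, -, hx⟩ := ih i
    obtain ⟨-, xx', hx'⟩ := ih (i + 1)
    have e1 := leibniz_lie (ξ 0 - (2 : ℂ) • η 0) (h i) (h j)
    rw [hh, lie_sub, lie_smul, lie_smul, hZG, s.γ_c, s.γ_h, s.γ_h, neg_lie, smul_lie, lie_neg,
      lie_smul] at e1
    have e2 := leibniz_lie e (ξ (i + 1)) (ξ j)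
    rw [xx', lie_sub, lie_smul, lie_smul, hZe, s.lie_c, s.lie_ξ, s.lie_ξ, smul_lie, lie_smul,
      hx'] at e2
    have e3 := leibniz_lie (ξ 0 - (2 : ℂ) • η 0) (h i) (ξ j)
    rw [hx, lie_smul, s.γ_h, s.γ_ξ, neg_lie, smul_lie, lie_smul, xx'] at e3
    simp only [show i + 1 + j = i + j + 1 by omega, show i + (j + 1) = i + j + 1 by omega] at *
    have r1 : ⁅h i, ξ (j + 1)⁆ =
        (2 : ℂ) • (ξ (i + j + 1 + 1) - (2 : ℂ) • η (i + j + 1 + 1)) := by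
      linear_combination (norm := module) (1 / 2 : ℂ) • e1 + (1 / 2 : ℂ) • e2
    have r2 : ⁅h i, h (j + 1)⁆ = ((j + 1 : ℕ) : ℂ) •
        ⁅ξ 0 - (2 : ℂ) • η 0, ξ (i + j + 1) - (2 : ℂ) • η (i + j + 1)⁆ -
          (2 : ℂ) • c (i + j + 1 + 1) := by
      push_cast
      linear_combination (norm := module) (-1 / 2 : ℂ) • e3
    refine ⟨r2, ?_, r1⟩
    have e4 := leibniz_lie e (h i) (ξ (j + 1))
    rw [r1, lie_smul, s.lie_γ, s.lie_h, s.lie_ξ, neg_lie, smul_lie, lie_smul, r2] at e4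
    linear_combination (norm := module) (1 / 2 : ℂ) • e4

theorem c_eq_zero (s : ClosedSumSystem e h ξ η c) (n : ℕ) : c n = 0 := by
  induction n using Nat.strong_induction_on with
  | _ n ih =>
  obtain rfl | ⟨m, rfl⟩ : n = 0 ∨ ∃ m, n = m + 1 := by
    cases n
    · exact Or.inl rfl
    · exact Or.inr ⟨_, rfl⟩
  · exact s.c_zero
  have e1 := (s.brackets m 0).2.1
  -- Antisymmetry: [ξ_0, ξ_m] is evaluated in both orders.
  rw [← lie_skew, s.ξ_ξ_zero, zero_add] at e1
  obtain _ | m := m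
  · simp only [Nat.cast_zero, zero_smul] at e1
    linear_combination (norm := module) (1 / 4 : ℂ) • e1
  · rw [s.γ_γ, ih m (by omega)] at e1
    have e2 : ((2 * (m + 3) : ℕ) : ℂ) • c (m + 2) = 0 := by
      push_cast at e1 ⊢
      linear_combination (norm := module) e1
    exact (smul_eq_zero.mp e2).resolve_left (Nat.cast_ne_zero.mpr (by omega))

end ClosedSumSystem
end ImaginaryRoots

/-! ### Closed sums in the algebra -/

section ClosedSums

theorem sum_range_natCast {M : Type*} [AddCommMonoid M] {N : ℕ} [NeZero N] (f : ZMod N → M) :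
    ∑ j ∈ Finset.range N, f (j : ZMod N) = ∑ k, f k := by
  refine Finset.sum_nbij' (fun j => (j : ZMod N)) ZMod.val ?_ ?_ ?_ ?_ ?_
  · simp
  · intro k _; simpa using ZMod.val_lt k
  · intro j hj; exact ZMod.val_cast_of_lt (by simpa using hj)
  · intro k _; exact ZMod.natCast_rightInverse k
  · simp

variable {L : Type*} [LieRing L] [LieAlgebra ℂ L] {N : ℕ} {g : ZMod N → L}

/-- Only the strings starting at i-1, i, i+1 contribute, with multiples 1, -2, 1 of S_i(qN+1). -/
theorem OnsagerRel.lie_sum_nest (h : OnsagerRel g) [NeZero N] {q : ℕ} (hq : 1 ≤ q)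
    (i : ZMod N) : ⁅g i, ∑ k, nest g k (q * N)⁆ = 0 := by
  have hN := h.three_le
  have hne1 : (1 : ZMod N) ≠ 0 := by
    simpa using natCast_ne_zero_of_lt (N := N) (k := 1) (by omega) (by omega)
  have hne2 : (2 : ZMod N) ≠ 0 := by
    simpa using natCast_ne_zero_of_lt (N := N) (k := 2) (by omega) (by omega)
  have hc := h.col hq
  rw [lie_sum, ← Finset.sum_subset (Finset.subset_univ {i - 1, i, i + 1}),
    Finset.sum_insert, Finset.sum_insert, Finset.sum_singleton]
  · have e1 := hc.up (i - 1)
    rw [sub_add_cancel] at e1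
    rw [e1, hc.self, nest_succ _ _ (Nat.mul_pos hq (by omega))]
    module
  · simpa using hne1
  · simp only [Finset.mem_insert, Finset.mem_singleton, not_or]
    constructor
    · intro e1; apply hne1; linear_combination -e1
    · intro e1; apply hne2; linear_combination -e1
  · intro k _ hk
    simp only [Finset.mem_insert, Finset.mem_singleton, not_or] at hk
    apply hc.zero
    · intro e1; exact hk.2.2 (by rw [e1]; ring)
    · exact fun e1 => hk.2.1 e1.symm
    · intro e1; exact hk.1 (by rw [e1]; ring)

theorem OnsagerRel.closedSumSystem (h : OnsagerRel g) [NeZero N] (a : ZMod N) :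
    ClosedSumSystem (g a) (fun q => nest g a ((q + 1) * N)) (fun q => nest g a ((q + 1) * N + 1))
      (fun q => nest g (a + 1) (q * N + (N - 1))) (fun q => ∑ k, nest g k ((q + 1) * N)) := by
  obtain ⟨M, hM, hM1⟩ : ∃ M, N = M + 2 ∧ 1 ≤ M := ⟨N - 2, by have := h.three_le; omega,
    by have := h.three_le; omega⟩
  have hM' : N - 1 = M + 1 := by omega
  have hcast : ((M : ℕ) : ZMod N) = -2 := by
    have : ((M + 2 : ℕ) : ZMod N) = 0 := by rw [← hM]; exact ZMod.natCast_self N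
    push_cast at this; linear_combination this
  have hcl : ∀ q, ⁅nest g a (q * N + 1), nest g (a + 1) (M + 1)⁆ =
      nest g a ((q + 1) * N) - ∑ k, nest g k ((q + 1) * N) := by
    intro q
    have e1 := h.nest_lie_nest_closing q (s := M + 1) (by omega) le_rfl (by omega) a
    have e2 := sum_range_natCast (fun k : ZMod N => nest g (a - 1 - k) ((q + 1) * N))
    rw [show ∑ k, nest g (a - 1 - k) ((q + 1) * N) = ∑ k, nest g k ((q + 1) * N) from
        Equiv.sum_comp (Equiv.subLeft (a - 1)) (fun k => nest g k ((q + 1) * N)),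
      show Finset.range N = Finset.range (M + 1 + 1) by rw [hM], Finset.sum_range_succ] at e2
    rw [Nat.cast_one] at e1
    rw [e1, ← e2]
    push_cast
    rw [hcast, show a - 1 - (-2 + 1 : ZMod N) = a by ring]
    abel
  have hc0 : ∀ q, ∀ y r, ⁅nest g y r, ∑ k, nest g k ((q + 1) * N)⁆ = 0 := fun q y r =>
    lie_nest_eq_zero fun j _ => h.lie_sum_nest (by omega) _
  refine ⟨fun q => (h.row (q + 1)).diag a, fun q => (h.col (by omega)).self a, ?_, ?_, ?_, ?_,
    fun q => h.lie_sum_nest (by omega) a, fun q => hc0 q _ _, fun q => hc0 q _ _, ?_⟩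
  · intro q
    rw [← nest_succ _ _ (by omega)]
    congr 1
    rw [add_one_mul]; omega
  · intro q
    simpa only [zero_mul, zero_add, hM'] using hcl (q + 1)
  · intro q
    have e1 := h.lie_nest_short (q + 1) (s := M) hM1 (p := 1) le_rfl (by omega) (a + 1)
    have e2 := h.nest_short_lie_multiple (q := q + 1) (by omega) hM1 (by omega) (a + 1 + 1)
    rw [show a + 1 + 1 + (M : ZMod N) = a by rw [hcast]; ring] at e2
    have e3 := (h.col (q := q + 1) (by omega)).up a
    rw [Nat.cast_one] at e1
    simp only [zero_mul, zero_add, hM']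
    rw [nest_succ g (a + 1) hM1, leibniz_lie, ← lie_skew (nest g a _) (g (a + 1)), e3,
      neg_lie, e1, ← lie_skew (nest g a _) (nest g (a + 1 + 1) M), e2, lie_neg,
      ← nest_succ _ _ (by omega), show (q + 1) * N + 1 + M = (q + 1) * N + (M + 1) by ring,
      add_assoc]
    module
  · intro q
    have e1 := h.nest_lie_nest_sum (q + 1) (s := M + 1) (by omega) (by omega) (a + 1)
    have e2 := sum_range_natCast (fun k : ZMod N => nest g (a + 1 + k) ((q + 1) * N))
    rw [show ∑ k, nest g (a + 1 + k) ((q + 1) * N) = ∑ k, nest g k ((q + 1) * N) from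
        Equiv.sum_comp (Equiv.addLeft (a + 1)) (fun k => nest g k ((q + 1) * N)),
      show Finset.range N = Finset.range (M + 1 + 1) by rw [hM], Finset.sum_range_succ] at e2
    simp only [zero_mul, zero_add, hM']
    rw [e1, ← e2]
    push_cast
    rw [hcast, show a + 1 + (-2 + 1 : ZMod N) = a by ring]
    module
  -- Here the long string is just `g a`, so the bracket is S_a(N) by definition and the closing
  -- formula forces c_0 = 0.
  · have e1 := hcl 0
    have e2 := nest_succ g a (r := M + 1) (by omega)
    rw [zero_mul, zero_add, nest_one, ← e2, one_mul,
      show nest g a N = nest g a (M + 1 + 1) from congrArg (nest g a) hM] at e1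
    simpa only [zero_add, one_mul] using sub_eq_self.mp e1.symm

theorem OnsagerRel.sum_nest_eq_zero (h : OnsagerRel g) [NeZero N] (m : ℕ) :
    ∑ k, nest g k ((m + 1) * N) = 0 :=
  (h.closedSumSystem 0).c_eq_zero m

end ClosedSums

/-! ### Return to the presented algebra -/

section Presentation

variable {N : ℕ}

theorem mk_eq_zero_of_isRelator {y : FreeLieAlgebra ℂ (ZMod N)} (hy : IsRelator N y) :
    (LieSubmodule.Quotient.mk y : SlNAlgebra N) = 0 :=
  (LieSubmodule.Quotient.mk_eq_zero' (N := relationIdeal N)).2 (LieSubmodule.subset_lieSpan hy)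

theorem lie_lie_e {i j : ZMod N} (hij : Adjacent i j) :
    ⁅(e i : SlNAlgebra N), ⁅(e i : SlNAlgebra N), e j⁆⁆ = e j :=
  sub_eq_zero.mp (mk_eq_zero_of_isRelator (.adjacent i j hij))

theorem lie_e {i j : ZMod N} (hij : ¬ Adjacent i j) : ⁅(e i : SlNAlgebra N), e j⁆ = 0 :=
  mk_eq_zero_of_isRelator (.nonadjacent i j hij)

/-- The factor I changes the sign of the cubic relations. It costs nothing, as all strings in a
closed sum have the same length and share one power of I. -/
theorem onsagerRel (hN : 3 ≤ N) :
    OnsagerRel (fun i : ZMod N => Complex.I • (e i : SlNAlgebra N)) := by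
  have key : ∀ i j : ZMod N, Adjacent i j → ⁅Complex.I • (e i : SlNAlgebra N),
      ⁅Complex.I • (e i : SlNAlgebra N), Complex.I • e j⁆⁆ = -(Complex.I • e j) := by
    intro i j hij
    simp only [smul_lie, lie_smul, lie_lie_e hij]
    rw [smul_smul, Complex.I_mul_I, neg_one_smul]
  refine ⟨hN, fun i => key _ _ (Or.inl rfl), fun i => key _ _ (Or.inr rfl), fun i j h1 h2 => ?_⟩
  rw [smul_lie, lie_smul, lie_e (by rintro (h | h); exacts [h1 h, h2 h]), smul_zero, smul_zero]

theorem nest_smul_e (k : ZMod N) (r : ℕ) :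
    nest (fun i : ZMod N => Complex.I • (e i : SlNAlgebra N)) k r =
      Complex.I ^ r • string k r := by
  induction r generalizing k with
  | zero => simp [string]
  | succ r ih =>
    obtain _ | r := r
    · simp [string]
    · rw [nest_succ _ _ (by omega), ih, smul_lie, lie_smul, smul_smul, ← pow_succ']
      rfl

theorem closedSum_eq_zero (hN : 3 ≤ N) {m : ℕ} (hm : 1 ≤ m) : closedSum N m = 0 := by
  have : NeZero N := ⟨by omega⟩
  obtain ⟨n, rfl⟩ := Nat.exists_eq_add_of_le' hm
  have h0 := (onsagerRel hN).sum_nest_eq_zero n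
  simp only [nest_smul_e] at h0
  rw [← Finset.smul_sum, smul_eq_zero, or_iff_right (pow_ne_zero _ Complex.I_ne_zero),
    ← Equiv.sum_comp (Equiv.addLeft (1 : ZMod N)), ← sum_range_natCast] at h0
  rw [closedSum, ← h0, ← Finset.Ico_add_one_right_eq_Icc, Finset.sum_Ico_eq_sum_range,
    Nat.add_sub_cancel]
  refine Finset.sum_congr rfl fun j _ => ?_
  simp [mul_comm]

end Presentation
end OnsagerSl

theorem proposition2 (N : ℕ) (hN : 3 ≤ N) (m : ℕ) (hm : 1 ≤ m) :
    OnsagerSl.closedSum N m = 0 :=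
  OnsagerSl.closedSum_eq_zero hN hm
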